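/- Let $n\ge 1$ and let $M_0\subset\mathbb R^{n+1}$. There is a constant $c_3>0$ depending only on $n$ and $M_0$, and for every $T_0>0$ there is a constant $G>0$ depending only on $n$, $M_0$ and $T_0$, such that the following holds. Let $M$ be a non-empty closed smooth $n$-manifold, let $T_c>T_0$, and let $F:M\times[0,T_c)\to\mathbb R^{n+1}$ be a smooth family of immersions with a continuous unit normal field $\nu$, moving by mean curvature, $$\frac{\partial F}{\partial t}(p,t)=-H(p,t)\,\nu(p,t),$$ where $H=g^{ij}h_{ij}$, $g_{ij}=\langle\partial_iF,\partial_jF\rangle$ and $h_{ij}=-\langle\partial_i\partial_jF,\nu\rangle$ (so that $H=n/r$ on a round sphere of radius $r$ with its outer normal). Suppose that $F(M,0)=M_0$ and that the initial hypersurface is star-shaped about the origin with outer normal $\nu(\cdot,0)$, i.e. $\langle F(p,0),\nu(p,0)\rangle>0$ for all $p\in M$. Put $$f_0=\max_{p\in M}\langle F(p,0),\nu(p,0)\rangle^{-1},\qquad T=\min\Big\{\frac1{G f_0^4},\,T_0\Big\}.$$ Then $0<T\le T_0$, and for all $t\in[0,T]$ and $p\in M$ $$\langle F(p,t),\nu(p,t)\rangle>0\quad\text{and}\quad\langle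 F(p,t),\nu(p,t)\rangle^{-1}\le 2c_3f_0 .$$ -/

import Mathlib

open Set
open scoped Manifold ContDiff

noncomputable section

namespace StarMCF

/-- The ambient Euclidean space `ℝ^{n+1}`. -/
abbrev Amb (n : ℕ) : Type := EuclideanSpace ℝ (Fin (n + 1))

section Hypersurface

variable {n : ℕ} {M : Type*} [TopologicalSpace M] [ChartedSpace (EuclideanSpace ℝ (Fin n)) M]

/-- The parametrization `X : M → ℝ^{n+1}` read in the chart at `p`. -/
def localRep (X : M → Amb n) (p : M) : EuclideanSpace ℝ (Fin n) → Amb n :=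
  fun y => X ((extChartAt (𝓡 n) p).symm y)

/-- The coordinate derivative `∂ᵢ φ` of a map `φ` on `ℝⁿ`. -/
def partialD (i : Fin n) (φ : EuclideanSpace ℝ (Fin n) → Amb n) :
    EuclideanSpace ℝ (Fin n) → Amb n :=
  fun y => fderiv ℝ φ y (EuclideanSpace.single i 1)

/-- First fundamental form `g_{ij} = ⟨∂ᵢX, ∂ⱼX⟩` at `p`, in the chart at `p`. -/
def firstForm (X : M → Amb n) (p : M) : Matrix (Fin n) (Fin n) ℝ :=
  Matrix.of fun i j =>
    inner ℝ (partialD i (localRep X p) (extChartAt (𝓡 n) p p))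
      (partialD j (localRep X p) (extChartAt (𝓡 n) p p))

/-- Second fundamental form `h_{ij} = -⟨∂ᵢ∂ⱼX, N⟩` at `p` with respect to the unit normal `N`
at `p`, in the chart at `p`. The sign makes round spheres positive for the outer normal. -/
def secondForm (X : M → Amb n) (N : Amb n) (p : M) : Matrix (Fin n) (Fin n) ℝ :=
  Matrix.of fun i j =>
    -inner ℝ (partialD i (partialD j (localRep X p)) (extChartAt (𝓡 n) p p)) N

/-- Mean curvature `H = g^{ij} h_{ij}` at `p` with respect to the unit normal `N` at `p`
(so `H = n / r` on the round sphere of radius `r` with its outer normal). -/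
def meanCurvature (X : M → Amb n) (N : Amb n) (p : M) : ℝ :=
  ((firstForm X p)⁻¹ * secondForm X N p).trace

/-- `F : M × [0, Tc) → ℝ^{n+1}` is a smooth family of immersed hypersurfaces with continuous
unit normal field `ν`, moving by mean curvature: `∂F/∂t = -H ν` (one-sided at `t = 0`). -/
structure IsMeanCurvatureFlow (Tc : ℝ) (F ν : M → ℝ → Amb n) : Prop where
  smooth : ContMDiffOn ((𝓡 n).prod 𝓘(ℝ, ℝ)) 𝓘(ℝ, Amb n) ∞
    (fun q : M × ℝ => F q.1 q.2) (univ ×ˢ Ico 0 Tc)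
  immersion : ∀ t ∈ Ico 0 Tc, ∀ p : M,
    Function.Injective (mfderiv (𝓡 n) 𝓘(ℝ, Amb n) (fun q => F q t) p)
  normal_continuous : ContinuousOn (fun q : M × ℝ => ν q.1 q.2) (univ ×ˢ Ico 0 Tc)
  normal_unit : ∀ t ∈ Ico 0 Tc, ∀ p : M, ‖ν p t‖ = 1
  normal_orthogonal : ∀ t ∈ Ico 0 Tc, ∀ p : M, ∀ v : TangentSpace (𝓡 n) p,
    inner ℝ (E := Amb n) (mfderiv (𝓡 n) 𝓘(ℝ, Amb n) (fun q => F q t) p v) (ν p t) = 0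
  evolution : ∀ t ∈ Ico 0 Tc, ∀ p : M,
    HasDerivWithinAt (F p) (-(meanCurvature (fun q => F q t) (ν p t) p) • ν p t) (Ico 0 Tc) t

/-- A hypersurface `X` with unit normal field `N` is star-shaped about the origin, with `N` its
outer normal, if the support function `⟨X, N⟩` is positive everywhere. -/
def IsStarShaped (X N : M → Amb n) : Prop :=
  ∀ p, 0 < inner ℝ (X p) (N p)

end Hypersurface

end StarMCF

end

/-!
Write `u = ⟪F, ν⟫`. Along the flow `∂ₜu = -H + ⟪F, ∇H⟫`, while by Codazzi
`Δu = H + ⟪F, ∇H⟫ - |A|² u`. Where `u(·, t)` attains a positive minimum, `Δu ≥ 0` and hence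
`∂ₜu ≥ |A|² u - 2 H ≥ -n / u`, because `u ∑ᵢ (κᵢ - 1 / u)² ≥ 0` for the principal curvatures
`κᵢ`. The maximum principle gives `u(p, t)² ≥ m² - 2 n t` with `m = min u(·, 0) = 1 / f₀`, with
equality on shrinking spheres, so `u ≥ 1 / (2 f₀)` as long as `8 n t ≤ 3 / f₀²`. The set `M₀`
only serves to trade `f₀²` for `f₀⁴`, as `1 / f₀ ≤ max ‖F(·, 0)‖`.
-/

noncomputable section

namespace StarMCF

open Filter Topology
open scoped RealInnerProductSpace

/-- The derivative of `f` in the constant direction `v`, as a function of the base point, so that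
it can be iterated. -/
def dirDeriv {E G : Type*} [NormedAddCommGroup E] [NormedSpace ℝ E] [NormedAddCommGroup G]
    [NormedSpace ℝ G] (v : E) (f : E → G) : E → G :=
  fun z => fderiv ℝ f z v

local notation:max "∂[" v "]" => dirDeriv v
local notation:max "ℝ^" n:max => EuclideanSpace ℝ (Fin n)

section DirectionalDerivative

variable {E G : Type*} [NormedAddCommGroup E] [NormedSpace ℝ E]
  [NormedAddCommGroup G] [NormedSpace ℝ G]

theorem dirDeriv_const (v : E) (c : G) : ∂[v] (fun _ : E => c) = fun _ => 0 := by
  funext z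
  simp [dirDeriv]

theorem dirDeriv_congr {f g : E → G} {z : E} (v : E) (h : f =ᶠ[𝓝 z] g) :
    ∂[v] f =ᶠ[𝓝 z] ∂[v] g :=
  h.fderiv.mono fun _ hy => congrArg (fun L : E →L[ℝ] G => L v) hy

theorem contDiffAt_dirDeriv {m k : WithTop ℕ∞} {f : E → G} {z : E} (hf : ContDiffAt ℝ k f z)
    (v : E) (hm : m + 1 ≤ k) : ContDiffAt ℝ m (∂[v] f) z :=
  (hf.fderiv_right hm).clm_apply contDiffAt_const

theorem differentiableAt_dirDeriv {f : E → G} {z : E} (hf : ContDiffAt ℝ 2 f z) (v : E) :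
    DifferentiableAt ℝ (∂[v] f) z :=
  (contDiffAt_dirDeriv hf v one_add_one_eq_two.le).differentiableAt one_ne_zero

theorem dirDeriv_dirDeriv {f : E → G} {z : E} (hf : ContDiffAt ℝ 2 f z) (v w : E) :
    ∂[v] (∂[w] f) z = fderiv ℝ (fderiv ℝ f) z v w := by
  have h : DifferentiableAt ℝ (fderiv ℝ f) z :=
    (hf.fderiv_right one_add_one_eq_two.le).differentiableAt one_ne_zero
  change fderiv ℝ (fun y => fderiv ℝ f y w) z v = _
  rw [fderiv_clm_apply h (differentiableAt_const w)]
  simp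

theorem dirDeriv_comm {f : E → G} {z : E} (hf : ContDiffAt ℝ 2 f z) (v w : E) :
    ∂[v] (∂[w] f) z = ∂[w] (∂[v] f) z := by
  rw [dirDeriv_dirDeriv hf, dirDeriv_dirDeriv hf]
  exact (hf.isSymmSndFDerivAt (by simp)).eq v w

theorem dirDeriv_comp_prodMk {f : E × ℝ → G} {z : E} {t : ℝ} (hf : DifferentiableAt ℝ f (z, t))
    (w : E) : ∂[w] (fun y => f (y, t)) z = ∂[(w, (0 : ℝ))] f (z, t) := by
  have h : HasFDerivAt (fun y => f (y, t)) _ z :=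
    hf.hasFDerivAt.comp z (hasFDerivAt_prodMk_left (𝕜 := ℝ) z t)
  simp [dirDeriv, h.fderiv]

theorem hasDerivAt_comp_prodMk {f : E × ℝ → G} {z : E} {t : ℝ}
    (hf : DifferentiableAt ℝ f (z, t)) :
    HasDerivAt (fun s => f (z, s)) (∂[((0 : E), (1 : ℝ))] f (z, t)) t := by
  simpa [dirDeriv, Function.comp_def] using
    (hf.hasFDerivAt.comp t (hasFDerivAt_prodMk_right (𝕜 := ℝ) z t)).hasDerivAt

theorem hasDerivAt_comp_line {f : E → G} {z v : E} {s : ℝ}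
    (hf : DifferentiableAt ℝ f (z + s • v)) :
    HasDerivAt (fun s : ℝ => f (z + s • v)) (∂[v] f (z + s • v)) s :=
  hf.hasFDerivAt.comp_hasDerivAt s <| by
    simpa using ((hasDerivAt_id s).smul_const v).const_add z

theorem deriv_deriv_comp_line {f : E → G} {z : E} (hf : ContDiffAt ℝ 2 f z) (v : E) :
    deriv (deriv fun s : ℝ => f (z + s • v)) 0 = ∂[v] (∂[v] f) z := by
  have hline : Tendsto (fun s : ℝ => z + s • v) (𝓝 0) (𝓝 z) :=
    Continuous.tendsto' (by fun_prop) _ _ (by simp)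
  have hderiv : deriv (fun s : ℝ => f (z + s • v)) =ᶠ[𝓝 0] fun s => ∂[v] f (z + s • v) :=
    (hline.eventually (hf.eventually (by simp))).mono fun s hs =>
      (hasDerivAt_comp_line (hs.differentiableAt two_ne_zero)).deriv
  have hsecond := hasDerivAt_comp_line (f := ∂[v] f) (z := z) (v := v) (s := 0)
    (by simpa using differentiableAt_dirDeriv hf v)
  rw [hderiv.deriv_eq, hsecond.deriv, zero_smul, add_zero]

-- If the second derivative were negative, `a` would also be a local maximum, so `f` would be
-- constant near `a`.
theorem deriv_deriv_nonneg_of_isLocalMin {f : ℝ → ℝ} {a : ℝ} (hmin : IsLocalMin f a)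
    (hf : ContinuousAt f a) : 0 ≤ deriv (deriv f) a := by
  by_contra! hneg
  have hmax : IsLocalMax f a := isLocalMax_of_deriv_deriv_neg hneg hmin.deriv_eq_zero hf
  have hconst : f =ᶠ[𝓝 a] fun _ => f a := by
    filter_upwards [hmin, hmax] with s h h' using le_antisymm h' h
  rw [hconst.deriv.deriv_eq] at hneg
  simp at hneg

theorem dirDeriv_dirDeriv_nonneg_of_isLocalMin {f : E → ℝ} {z : E} (hf : ContDiffAt ℝ 2 f z)
    (hmin : IsLocalMin f z) (v : E) : 0 ≤ ∂[v] (∂[v] f) z := by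
  rw [← deriv_deriv_comp_line hf]
  have hline : Tendsto (fun s : ℝ => z + s • v) (𝓝 0) (𝓝 z) :=
    Continuous.tendsto' (by fun_prop) _ _ (by simp)
  refine deriv_deriv_nonneg_of_isLocalMin ?_
    (ContinuousAt.comp (by simpa using hf.continuousAt) (by fun_prop))
  simpa [IsLocalMin, IsMinFilter] using hline.eventually hmin

theorem dirDeriv_eq_zero_of_isLocalMin {f : E → ℝ} {z : E} (hmin : IsLocalMin f z) (v : E) :
    ∂[v] f z = 0 := by
  simp [dirDeriv, hmin.fderiv_eq_zero]

end DirectionalDerivative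

section InnerProduct

variable {E A : Type*} [NormedAddCommGroup E] [NormedSpace ℝ E]
  [NormedAddCommGroup A] [InnerProductSpace ℝ A] {f g : E → A} {z : E}

theorem dirDeriv_inner (hf : DifferentiableAt ℝ f z) (hg : DifferentiableAt ℝ g z) (v : E) :
    ∂[v] (fun y => ⟪f y, g y⟫) z = ⟪f z, ∂[v] g z⟫ + ⟪∂[v] f z, g z⟫ :=
  fderiv_inner_apply ℝ hf hg v

theorem dirDeriv_dirDeriv_inner (hf : ContDiffAt ℝ 2 f z) (hg : ContDiffAt ℝ 2 g z) (v : E) :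
    ∂[v] (∂[v] fun y => ⟪f y, g y⟫) z
      = ⟪f z, ∂[v] (∂[v] g) z⟫ + 2 * ⟪∂[v] f z, ∂[v] g z⟫ + ⟪∂[v] (∂[v] f) z, g z⟫ := by
  have hfirst : ∂[v] (fun y => ⟪f y, g y⟫) =ᶠ[𝓝 z]
      fun y => ⟪f y, ∂[v] g y⟫ + ⟪∂[v] f y, g y⟫ := by
    filter_upwards [hf.eventually (by simp), hg.eventually (by simp)] with y hfy hgy
    exact dirDeriv_inner (hfy.differentiableAt two_ne_zero) (hgy.differentiableAt two_ne_zero) v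
  have hf' := hf.differentiableAt two_ne_zero
  have hg' := hg.differentiableAt two_ne_zero
  have hdf := differentiableAt_dirDeriv hf v
  have hdg := differentiableAt_dirDeriv hg v
  calc ∂[v] (∂[v] fun y => ⟪f y, g y⟫) z
      = ∂[v] (fun y => ⟪f y, ∂[v] g y⟫ + ⟪∂[v] f y, g y⟫) z :=
        (dirDeriv_congr v hfirst).eq_of_nhds
    _ = ∂[v] (fun y => ⟪f y, ∂[v] g y⟫) z + ∂[v] (fun y => ⟪∂[v] f y, g y⟫) z :=
        congrArg (· v) (fderiv_fun_add (hf'.inner ℝ hdg) (hdf.inner ℝ hg'))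
    _ = _ := by rw [dirDeriv_inner hf' hdg, dirDeriv_inner hdf hg']; ring

theorem inner_dirDeriv_eq_neg {c : ℝ} (hf : DifferentiableAt ℝ f z)
    (hg : DifferentiableAt ℝ g z) (hc : ∀ᶠ y in 𝓝 z, ⟪f y, g y⟫ = c) (v : E) :
    ⟪f z, ∂[v] g z⟫ = -⟪∂[v] f z, g z⟫ := by
  have h := (dirDeriv_congr v hc).eq_of_nhds
  rw [dirDeriv_inner hf hg, dirDeriv_const] at h
  exact eq_neg_of_add_eq_zero_left h

theorem inner_dirDeriv_dirDeriv_eq_neg {c : ℝ} (hf : ContDiffAt ℝ 2 f z)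
    (hg : ContDiffAt ℝ 2 g z) (hc : ∀ᶠ y in 𝓝 z, ⟪f y, g y⟫ = c) (v : E) :
    ⟪f z, ∂[v] (∂[v] g) z⟫
      = -(2 * ⟪∂[v] f z, ∂[v] g z⟫ + ⟪∂[v] (∂[v] f) z, g z⟫) := by
  have h := (dirDeriv_congr v (dirDeriv_congr v hc)).eq_of_nhds
  rw [dirDeriv_dirDeriv_inner hf hg, dirDeriv_const, dirDeriv_const] at h
  linarith

end InnerProduct

section Frame

variable {ι V : Type*} [Fintype ι] [NormedAddCommGroup V] [InnerProductSpace ℝ V]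

theorem eq_inner_smul_add_sum_inner_smul [FiniteDimensional ℝ V]
    (hcard : Module.finrank ℝ V = Fintype.card ι + 1) {b : ι → V} {N : V} (hb : Orthonormal ℝ b)
    (hN : ‖N‖ = 1) (hbN : ∀ i, ⟪b i, N⟫ = 0) (v : V) :
    v = ⟪N, v⟫ • N + ∑ i, ⟪b i, v⟫ • b i := by
  classical
  have hNb : ∀ i, ⟪N, b i⟫ = 0 := fun i => (real_inner_comm _ _).trans (hbN i)
  have ho : Orthonormal ℝ (fun o : Option ι => o.elim N b) := by
    rw [orthonormal_iff_ite] at hb ⊢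
    rintro (_ | i) (_ | j) <;> simp [hN, hb, hbN, hNb]
  have hspan : ⊤ ≤ Submodule.span ℝ (range fun o : Option ι => o.elim N b) := by
    rw [ho.linearIndependent.span_eq_top_of_card_eq_finrank' (by simp [hcard])]
  simpa [Fintype.sum_option] using ((OrthonormalBasis.mk ho hspan).sum_repr' v).symm

end Frame

section MatrixTrace

attribute [local instance] Matrix.linftyOpNormedRing Matrix.linftyOpNormedAlgebra

variable {E ι : Type*} [NormedAddCommGroup E] [NormedSpace ℝ E] [Fintype ι] [DecidableEq ι]
  {g h : E → Matrix ι ι ℝ} {g' h' : ι → ι → E →L[ℝ] ℝ} {z : E}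

theorem hasFDerivAt_matrix_inv_apply_of_eq_one
    (hg : ∀ i j, HasFDerivAt (fun y => g y i j) (g' i j) z) (hone : g z = 1) (i j : ι) :
    HasFDerivAt (fun y => (g y)⁻¹ i j) (-g' i j) z := by
  have : CompleteSpace (Matrix ι ι ℝ) := FiniteDimensional.complete ℝ _
  have hgz : HasFDerivAt g (ContinuousLinearMap.pi fun i => ContinuousLinearMap.pi (g' i)) z :=
    hasFDerivAt_pi.2 fun i => hasFDerivAt_pi.2 (hg i)
  have hinv := hasFDerivAt_ringInverse (𝕜 := ℝ) (1 : (Matrix ι ι ℝ)ˣ)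
  rw [Units.val_one, ← hone] at hinv
  have hentry := hasFDerivAt_pi'.1 (hasFDerivAt_pi'.1 (hinv.comp z hgz) i) j
  refine (hentry.congr_of_eventuallyEq ?_).congr_fderiv ?_
  · exact .of_forall fun y => congrFun₂ (Matrix.nonsing_inv_eq_ringInverse (g y)) i j
  · ext v
    change (-(1 * Matrix.of (fun i j => g' i j v) * 1) : Matrix ι ι ℝ) i j = (-g' i j) v
    simp

theorem hasFDerivAt_trace_inv_mul_of_eq_one
    (hg : ∀ i j, HasFDerivAt (fun y => g y i j) (g' i j) z)
    (hh : ∀ i j, HasFDerivAt (fun y => h y i j) (h' i j) z) (hone : g z = 1) :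
    HasFDerivAt (fun y => ((g y)⁻¹ * h y).trace)
      (∑ i, h' i i - ∑ i, ∑ j, h z j i • g' i j) z := by
  have hentry : ∀ i j, HasFDerivAt (fun y => (g y)⁻¹ i j * h y j i) _ z := fun i j =>
    (hasFDerivAt_matrix_inv_apply_of_eq_one hg hone i j).mul (hh j i)
  refine (HasFDerivAt.fun_sum fun i _ =>
    HasFDerivAt.fun_sum fun j _ => hentry i j).congr_fderiv ?_
  simp [hone, Matrix.one_apply, Finset.sum_add_distrib, sub_eq_add_neg]

end MatrixTrace

section ChangeOfCoordinates

theorem trace_inv_mul_transpose_mul_mul {ι R : Type*} [Fintype ι] [DecidableEq ι] [CommRing R]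
    {J : Matrix ι ι R} (hJ : IsUnit J.det) (g h : Matrix ι ι R) :
    ((J.transpose * g * J)⁻¹ * (J.transpose * h * J)).trace = (g⁻¹ * h).trace := by
  have hJt : IsUnit J.transpose.det := by rwa [Matrix.det_transpose]
  calc ((J.transpose * g * J)⁻¹ * (J.transpose * h * J)).trace
      = (J⁻¹ * (g⁻¹ * (J.transpose⁻¹ * J.transpose) * h * J)).trace := by
        simp only [Matrix.mul_inv_rev, Matrix.mul_assoc]
    _ = (g⁻¹ * h).trace := by
        rw [Matrix.nonsing_inv_mul _ hJt, Matrix.mul_one, Matrix.trace_mul_comm, Matrix.mul_assoc,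
          Matrix.mul_nonsing_inv _ hJ, Matrix.mul_one]

theorem fderiv_fderiv_comp {E F G : Type*} [NormedAddCommGroup E] [NormedSpace ℝ E]
    [NormedAddCommGroup F] [NormedSpace ℝ F] [NormedAddCommGroup G] [NormedSpace ℝ G]
    {f : F → G} {ψ : E → F} {y : E} (hf : ContDiffAt ℝ 2 f (ψ y)) (hψ : ContDiffAt ℝ 2 ψ y)
    (v w : E) :
    fderiv ℝ (fderiv ℝ (f ∘ ψ)) y v w
      = fderiv ℝ (fderiv ℝ f) (ψ y) (fderiv ℝ ψ y v) (fderiv ℝ ψ y w)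
        + fderiv ℝ f (ψ y) (fderiv ℝ (fderiv ℝ ψ) y v w) := by
  have hfirst : fderiv ℝ (f ∘ ψ) =ᶠ[𝓝 y] fun y => (fderiv ℝ f (ψ y)).comp (fderiv ℝ ψ y) := by
    filter_upwards [hψ.eventually (by simp), hψ.continuousAt.eventually (hf.eventually (by simp))]
      with y hψy hfy
    exact fderiv_comp y (hfy.differentiableAt two_ne_zero) (hψy.differentiableAt two_ne_zero)
  have hdf : DifferentiableAt ℝ (fderiv ℝ f) (ψ y) :=
    (hf.fderiv_right one_add_one_eq_two.le).differentiableAt one_ne_zero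
  have hdψ : DifferentiableAt ℝ (fderiv ℝ ψ) y :=
    (hψ.fderiv_right one_add_one_eq_two.le).differentiableAt one_ne_zero
  have hsecond : HasFDerivAt (fun y => (fderiv ℝ f (ψ y)).comp (fderiv ℝ ψ y)) _ y :=
    (hdf.hasFDerivAt.comp y (hψ.differentiableAt two_ne_zero).hasFDerivAt).clm_comp
      hdψ.hasFDerivAt
  rw [hfirst.fderiv_eq, hsecond.fderiv]
  simp [add_comm]

variable {n : ℕ} {x : ℝ^n → Amb n} {N : Amb n} {z : ℝ^n}

/-- The coordinate vector `eᵢ` of `ℝⁿ`. -/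
abbrev coordVec (i : Fin n) : ℝ^n := EuclideanSpace.single i 1

theorem firstForm_apply (x : ℝ^n → Amb n) (z : ℝ^n) (i j : Fin n) :
    firstForm x z i j = ⟪∂[coordVec i] x z, ∂[coordVec j] x z⟫ := rfl

theorem secondForm_apply (x : ℝ^n → Amb n) (N : Amb n) (z : ℝ^n) (i j : Fin n) :
    secondForm x N z i j = -⟪∂[coordVec i] (∂[coordVec j] x) z, N⟫ := rfl

theorem meanCurvature_congr {x' : ℝ^n → Amb n} (h : x =ᶠ[𝓝 z] x') (N : Amb n) :
    meanCurvature x N z = meanCurvature x' N z := by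
  have hfirst : firstForm x z = firstForm x' z := by
    ext i j
    simp only [firstForm_apply, (dirDeriv_congr _ h).eq_of_nhds]
  have hsecond : secondForm x N z = secondForm x' N z := by
    ext i j
    simp only [secondForm_apply, (dirDeriv_congr _ (dirDeriv_congr _ h)).eq_of_nhds]
  rw [meanCurvature, meanCurvature, hfirst, hsecond]

local notation "𝓫" => OrthonormalBasis.toBasis (EuclideanSpace.basisFun _ ℝ)

theorem firstForm_eq_toMatrix₂ (x : ℝ^n → Amb n) (z : ℝ^n) :
    firstForm x z = LinearMap.toMatrix₂ 𝓫 𝓫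
      ((innerₗ (Amb n)).compl₁₂ (fderiv ℝ x z : ℝ^n →ₗ[ℝ] Amb n) (fderiv ℝ x z)) := by
  ext i j
  simp [firstForm_apply, dirDeriv, LinearMap.toMatrix₂_apply]

theorem secondForm_eq_toMatrix₂ (hx : ContDiffAt ℝ 2 x z) (N : Amb n) :
    secondForm x N z = LinearMap.toMatrix₂ 𝓫 𝓫
      ((fderiv ℝ (fderiv ℝ x) z).toLinearMap₁₂.compr₂ (-innerₗ (Amb n) N)) := by
  ext i j
  simp [secondForm_apply, dirDeriv_dirDeriv hx, LinearMap.toMatrix₂_apply, real_inner_comm N]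

theorem meanCurvature_comp {ψ : ℝ^n → ℝ^n} {y : ℝ^n} (hx : ContDiffAt ℝ 2 x (ψ y))
    (hψ : ContDiffAt ℝ 2 ψ y) (hψ' : (fderiv ℝ ψ y).IsInvertible)
    (hN : ∀ w, ⟪∂[w] x (ψ y), N⟫ = 0) :
    meanCurvature (x ∘ ψ) N y = meanCurvature x N (ψ y) := by
  set J := LinearMap.toMatrix 𝓫 𝓫 (fderiv ℝ ψ y : ℝ^n →ₗ[ℝ] ℝ^n) with hJ_def
  have hJ : IsUnit J.det := by
    obtain ⟨e, he⟩ := hψ'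
    rw [hJ_def, ← he]
    exact e.toLinearEquiv.isUnit_det 𝓫 𝓫
  have hfirst : firstForm (x ∘ ψ) y = J.transpose * firstForm x (ψ y) * J := by
    rw [firstForm_eq_toMatrix₂, firstForm_eq_toMatrix₂, ← LinearMap.toMatrix₂_compl₁₂,
      fderiv_comp y (hx.differentiableAt two_ne_zero) (hψ.differentiableAt two_ne_zero)]
    rfl
  have hsecond : secondForm (x ∘ ψ) N y = J.transpose * secondForm x N (ψ y) * J := by
    rw [secondForm_eq_toMatrix₂ (hx.comp y hψ), secondForm_eq_toMatrix₂ hx,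
      ← LinearMap.toMatrix₂_compl₁₂]
    congr 1
    ext v w
    have hnormal : ⟪N, fderiv ℝ x (ψ y) (fderiv ℝ (fderiv ℝ ψ) y v w)⟫ = 0 :=
      (real_inner_comm _ _).trans (hN _)
    simp [fderiv_fderiv_comp hx hψ, inner_add_right, hnormal]
  rw [meanCurvature, meanCurvature, hfirst, hsecond, trace_inv_mul_transpose_mul_mul hJ]

end ChangeOfCoordinates

section SupportFunction

variable {n : ℕ}

theorem firstForm_eq_one {x : ℝ^n → Amb n} {z : ℝ^n}
    (hon : Orthonormal ℝ fun i => ∂[coordVec i] x z) : firstForm x z = 1 := by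
  ext i j
  simp [firstForm_apply, orthonormal_iff_ite.1 hon i j, Matrix.one_apply]

/-- Near `z`, the map `x` is a `C³` parametrization of a hypersurface with `C²` unit normal field
`ν`; both are read in coordinates. -/
structure IsUnitNormalAt (x ν : ℝ^n → Amb n) (z : ℝ^n) : Prop where
  contDiffAt : ContDiffAt ℝ 3 x z
  contDiffAt_normal : ContDiffAt ℝ 2 ν z
  norm_normal : ∀ᶠ y in 𝓝 z, ‖ν y‖ = 1
  inner_dirDeriv_normal : ∀ᶠ y in 𝓝 z, ∀ w, ⟪∂[w] x y, ν y⟫ = 0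

namespace IsUnitNormalAt

variable {x ν : ℝ^n → Amb n} {z : ℝ^n}

section

variable (h : IsUnitNormalAt x ν z)

include h

theorem differentiableAt_normal : DifferentiableAt ℝ ν z :=
  h.contDiffAt_normal.differentiableAt two_ne_zero

theorem contDiffAt_dirDeriv (w : ℝ^n) : ContDiffAt ℝ 2 (∂[w] x) z :=
  StarMCF.contDiffAt_dirDeriv h.contDiffAt w two_add_one_eq_three.le

theorem contDiffAt_two : ContDiffAt ℝ 2 x z :=
  h.contDiffAt.of_le (by norm_num)

theorem inner_self_normal : ∀ᶠ y in 𝓝 z, ⟪ν y, ν y⟫ = 1 :=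
  h.norm_normal.mono fun y hy => by simp [hy]

theorem inner_normal_dirDeriv_normal (v : ℝ^n) : ⟪ν z, ∂[v] ν z⟫ = 0 := by
  have hneg := inner_dirDeriv_eq_neg h.differentiableAt_normal h.differentiableAt_normal
    h.inner_self_normal v
  rw [real_inner_comm (ν z)] at hneg
  linarith

theorem inner_normal_dirDeriv_dirDeriv_normal (v : ℝ^n) :
    ⟪ν z, ∂[v] (∂[v] ν) z⟫ = -‖∂[v] ν z‖ ^ 2 := by
  have hneg := inner_dirDeriv_dirDeriv_eq_neg h.contDiffAt_normal h.contDiffAt_normal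
    h.inner_self_normal v
  rw [real_inner_comm (ν z), real_inner_self_eq_norm_sq] at hneg
  linarith

theorem inner_dirDeriv_dirDeriv_normal_eq_neg (v w : ℝ^n) :
    ⟪∂[w] x z, ∂[v] ν z⟫ = -⟪∂[v] (∂[w] x) z, ν z⟫ :=
  inner_dirDeriv_eq_neg ((h.contDiffAt_dirDeriv w).differentiableAt two_ne_zero)
    h.differentiableAt_normal (h.inner_dirDeriv_normal.mono fun _ hy => hy w) v

theorem inner_dirDeriv_dirDeriv_normal_comm (v w : ℝ^n) :
    ⟪∂[w] x z, ∂[v] ν z⟫ = ⟪∂[v] x z, ∂[w] ν z⟫ := by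
  rw [h.inner_dirDeriv_dirDeriv_normal_eq_neg, h.inner_dirDeriv_dirDeriv_normal_eq_neg,
    dirDeriv_comm h.contDiffAt_two]

theorem secondForm_apply (i j : Fin n) :
    secondForm x (ν z) z i j = ⟪∂[coordVec j] x z, ∂[coordVec i] ν z⟫ :=
  (h.inner_dirDeriv_dirDeriv_normal_eq_neg _ _).symm

theorem hasFDerivAt_firstForm_apply (i j : Fin n) :
    HasFDerivAt (fun y => firstForm x y i j)
      (fderiv ℝ (fun y => ⟪∂[coordVec i] x y, ∂[coordVec j] x y⟫) z) z :=
  (((h.contDiffAt_dirDeriv _).inner ℝ (h.contDiffAt_dirDeriv _)).differentiableAt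
    two_ne_zero).hasFDerivAt

theorem hasFDerivAt_secondForm_apply (i j : Fin n) :
    HasFDerivAt (fun y => secondForm x (ν y) y i j)
      (-fderiv ℝ (fun y => ⟪∂[coordVec i] (∂[coordVec j] x) y, ν y⟫) z) z :=
  ((differentiableAt_dirDeriv (h.contDiffAt_dirDeriv _) _).inner ℝ
    h.differentiableAt_normal).hasFDerivAt.neg

theorem dirDeriv_firstForm_apply (ξ : ℝ^n) (i j : Fin n) :
    ∂[ξ] (fun y => ⟪∂[coordVec i] x y, ∂[coordVec j] x y⟫) z
      = ⟪∂[coordVec i] x z, ∂[coordVec j] (∂[ξ] x) z⟫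
        + ⟪∂[coordVec i] (∂[ξ] x) z, ∂[coordVec j] x z⟫ := by
  rw [dirDeriv_inner ((h.contDiffAt_dirDeriv _).differentiableAt two_ne_zero)
      ((h.contDiffAt_dirDeriv _).differentiableAt two_ne_zero),
    dirDeriv_comm h.contDiffAt_two ξ, dirDeriv_comm h.contDiffAt_two ξ]

theorem dirDeriv_inner_dirDeriv_dirDeriv_normal (ξ v : ℝ^n) :
    ∂[ξ] (fun y => ⟪∂[v] (∂[v] x) y, ν y⟫) z
      = ⟪∂[v] (∂[v] x) z, ∂[ξ] ν z⟫ - 2 * ⟪∂[v] (∂[ξ] x) z, ∂[v] ν z⟫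
        - ⟪∂[ξ] x z, ∂[v] (∂[v] ν) z⟫ := by
  have hcomm : ∂[ξ] (∂[v] (∂[v] x)) z = ∂[v] (∂[v] (∂[ξ] x)) z := by
    rw [dirDeriv_comm (h.contDiffAt_dirDeriv v)]
    refine (dirDeriv_congr v ?_).eq_of_nhds
    exact (h.contDiffAt_two.eventually (by simp)).mono fun y hy => dirDeriv_comm hy ξ v
  have hneg := inner_dirDeriv_dirDeriv_eq_neg (h.contDiffAt_dirDeriv ξ) h.contDiffAt_normal
    (h.inner_dirDeriv_normal.mono fun _ hy => hy ξ) v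
  rw [dirDeriv_inner (differentiableAt_dirDeriv (h.contDiffAt_dirDeriv v) v)
    h.differentiableAt_normal, hcomm, hneg]
  ring

end

section OrthonormalFrame

variable (h : IsUnitNormalAt x ν z) (hon : Orthonormal ℝ fun i => ∂[coordVec i] x z)

include h hon

theorem eq_inner_normal_smul_add_sum (a : Amb n) :
    a = ⟪ν z, a⟫ • ν z + ∑ i, ⟪∂[coordVec i] x z, a⟫ • ∂[coordVec i] x z :=
  eq_inner_smul_add_sum_inner_smul (by simp) hon h.norm_normal.self_of_nhds
    (fun _ => h.inner_dirDeriv_normal.self_of_nhds _) a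

theorem exists_eq_inner_normal_smul_add_dirDeriv (a : Amb n) :
    ∃ ξ, a = ⟪ν z, a⟫ • ν z + ∂[ξ] x z :=
  ⟨∑ i, ⟪∂[coordVec i] x z, a⟫ • coordVec i, by
    simpa [dirDeriv] using h.eq_inner_normal_smul_add_sum hon a⟩

theorem sum_inner_dirDeriv_mul_secondForm (a : Amb n) (i : Fin n) :
    ∑ j, ⟪a, ∂[coordVec j] x z⟫ * secondForm x (ν z) z i j = ⟪a, ∂[coordVec i] ν z⟫ := by
  conv_rhs => rw [h.eq_inner_normal_smul_add_sum hon (∂[coordVec i] ν z)]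
  simp [h.inner_normal_dirDeriv_normal, h.secondForm_apply, inner_sum, inner_smul_right, mul_comm]

theorem meanCurvature_eq_sum :
    meanCurvature x (ν z) z = ∑ i, ⟪∂[coordVec i] x z, ∂[coordVec i] ν z⟫ := by
  simp [meanCurvature, firstForm_eq_one hon, Matrix.trace, h.secondForm_apply]

theorem differentiableAt_meanCurvature :
    DifferentiableAt ℝ (fun y => meanCurvature x (ν y) y) z :=
  (hasFDerivAt_trace_inv_mul_of_eq_one h.hasFDerivAt_firstForm_apply
    h.hasFDerivAt_secondForm_apply (firstForm_eq_one hon)).differentiableAt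

theorem sum_secondForm_mul_dirDeriv_firstForm (ξ : ℝ^n) :
    ∑ i, ∑ j, secondForm x (ν z) z j i
        * ∂[ξ] (fun y => ⟪∂[coordVec i] x y, ∂[coordVec j] x y⟫) z
      = 2 * ∑ i, ⟪∂[coordVec i] (∂[ξ] x) z, ∂[coordVec i] ν z⟫ := by
  simp only [h.dirDeriv_firstForm_apply, mul_add, Finset.sum_add_distrib, two_mul,
    ← h.sum_inner_dirDeriv_mul_secondForm hon (∂[coordVec _] (∂[ξ] x) z)]
  congr 1
  · rw [Finset.sum_comm]
    exact Finset.sum_congr rfl fun j _ => Finset.sum_congr rfl fun i _ => by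
      rw [real_inner_comm, mul_comm]
  · exact Finset.sum_congr rfl fun i _ => Finset.sum_congr rfl fun j _ => by
      rw [h.secondForm_apply, h.secondForm_apply, h.inner_dirDeriv_dirDeriv_normal_comm, mul_comm]

-- The traced Codazzi equation: the terms `⟨∂ᵢ∂_ξ x, ∂ᵢν⟩` coming from the metric and from the
-- second fundamental form cancel.
theorem dirDeriv_meanCurvature (ξ : ℝ^n) :
    ∂[ξ] (fun y => meanCurvature x (ν y) y) z
      = ∑ i, (⟪∂[ξ] x z, ∂[coordVec i] (∂[coordVec i] ν) z⟫
        - ⟪∂[coordVec i] (∂[coordVec i] x) z, ∂[ξ] ν z⟫) := by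
  have htrace := (hasFDerivAt_trace_inv_mul_of_eq_one h.hasFDerivAt_firstForm_apply
    h.hasFDerivAt_secondForm_apply (firstForm_eq_one hon)).fderiv
  calc ∂[ξ] (fun y => meanCurvature x (ν y) y) z
      = ∑ i, -∂[ξ] (fun y => ⟪∂[coordVec i] (∂[coordVec i] x) y, ν y⟫) z
        - ∑ i, ∑ j, secondForm x (ν z) z j i
          * ∂[ξ] (fun y => ⟪∂[coordVec i] x y, ∂[coordVec j] x y⟫) z := by
        have hξ := congrArg (· ξ) htrace
        simpa [dirDeriv, meanCurvature] using hξ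
    _ = _ := by
      rw [h.sum_secondForm_mul_dirDeriv_firstForm hon, Finset.mul_sum, ← Finset.sum_sub_distrib]
      refine Finset.sum_congr rfl fun i _ => ?_
      rw [h.dirDeriv_inner_dirDeriv_dirDeriv_normal]
      ring

theorem two_mul_meanCurvature_le {u : ℝ} (hu : 0 < u) :
    2 * meanCurvature x (ν z) z ≤ n / u + u * ∑ i, ‖∂[coordVec i] ν z‖ ^ 2 := by
  have hterm (i : Fin n) : 2 * ⟪∂[coordVec i] x z, ∂[coordVec i] ν z⟫
      ≤ 1 / u + u * ‖∂[coordVec i] ν z‖ ^ 2 := by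
    set A := ‖∂[coordVec i] ν z‖
    have hcs : ⟪∂[coordVec i] x z, ∂[coordVec i] ν z⟫ ≤ A := by
      simpa [hon.1 i] using real_inner_le_norm (∂[coordVec i] x z) (∂[coordVec i] ν z)
    have hsq : 1 / u + u * A ^ 2 - 2 * A = u * (A - 1 / u) ^ 2 := by
      field_simp
      ring
    have : 0 ≤ u * (A - 1 / u) ^ 2 := by positivity
    linarith
  calc 2 * meanCurvature x (ν z) z
      = ∑ i, 2 * ⟪∂[coordVec i] x z, ∂[coordVec i] ν z⟫ := by
        rw [h.meanCurvature_eq_sum hon, Finset.mul_sum]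
    _ ≤ ∑ i, (1 / u + u * ‖∂[coordVec i] ν z‖ ^ 2) := Finset.sum_le_sum fun i _ => hterm i
    _ = n / u + u * ∑ i, ‖∂[coordVec i] ν z‖ ^ 2 := by
        simp [Finset.sum_add_distrib, Finset.mul_sum, div_eq_mul_inv]

end OrthonormalFrame

section CriticalPoint

variable (h : IsUnitNormalAt x ν z) (hcrit : ∀ v, ∂[v] (fun y => ⟪x y, ν y⟫) z = 0)

include h hcrit

theorem inner_dirDeriv_normal_eq_zero (v : ℝ^n) : ⟪x z, ∂[v] ν z⟫ = 0 := by
  have hv := hcrit v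
  rwa [dirDeriv_inner (h.contDiffAt.differentiableAt three_ne_zero) h.differentiableAt_normal,
    h.inner_dirDeriv_normal.self_of_nhds, add_zero] at hv

variable (hon : Orthonormal ℝ fun i => ∂[coordVec i] x z) {ξ : ℝ^n}
  (hξ : x z = ⟪ν z, x z⟫ • ν z + ∂[ξ] x z)

include hon hξ

theorem dirDeriv_normal_eq_zero : ∂[ξ] ν z = 0 := by
  have htangential (v : ℝ^n) : ⟪∂[v] x z, ∂[ξ] ν z⟫ = 0 := by
    have hv := h.inner_dirDeriv_normal_eq_zero hcrit v
    rwa [hξ, inner_add_left, inner_smul_left, h.inner_normal_dirDeriv_normal, mul_zero, zero_add,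
      h.inner_dirDeriv_dirDeriv_normal_comm] at hv
  rw [h.eq_inner_normal_smul_add_sum hon (∂[ξ] ν z)]
  simp [h.inner_normal_dirDeriv_normal, htangential]

theorem sum_dirDeriv_dirDeriv_inner_normal :
    ∑ i, ∂[coordVec i] (∂[coordVec i] fun y => ⟪x y, ν y⟫) z
      = meanCurvature x (ν z) z + ∂[ξ] (fun y => meanCurvature x (ν y) y) z
        - ⟪x z, ν z⟫ * ∑ i, ‖∂[coordVec i] ν z‖ ^ 2 := by
  have hterm (i : Fin n) : ∂[coordVec i] (∂[coordVec i] fun y => ⟪x y, ν y⟫) z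
      = ⟪∂[coordVec i] x z, ∂[coordVec i] ν z⟫
        + ⟪∂[ξ] x z, ∂[coordVec i] (∂[coordVec i] ν) z⟫
        - ⟪x z, ν z⟫ * ‖∂[coordVec i] ν z‖ ^ 2 := by
    have hsplit := congrArg (⟪·, ∂[coordVec i] (∂[coordVec i] ν) z⟫) hξ
    simp only [inner_add_left, real_inner_smul_left,
      h.inner_normal_dirDeriv_dirDeriv_normal] at hsplit
    rw [dirDeriv_dirDeriv_inner h.contDiffAt_two h.contDiffAt_normal, hsplit,
      h.inner_dirDeriv_dirDeriv_normal_eq_neg, real_inner_comm (x z)]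
    ring
  simp only [hterm, Finset.sum_add_distrib, Finset.sum_sub_distrib, ← Finset.mul_sum,
    h.meanCurvature_eq_sum hon, h.dirDeriv_meanCurvature hon,
    h.dirDeriv_normal_eq_zero hcrit hon hξ, inner_zero_right, sub_zero]

end CriticalPoint

-- `W` stands for the time derivative `∇H` of the normal under mean curvature flow.
theorem neg_div_le_of_isLocalMin (h : IsUnitNormalAt x ν z)
    (hon : Orthonormal ℝ fun i => ∂[coordVec i] x z)
    (hmin : IsLocalMin (fun y => ⟪x y, ν y⟫) z) (hpos : 0 < ⟪x z, ν z⟫) {W : Amb n}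
    (hWν : ⟪ν z, W⟫ = 0)
    (hW : ∀ w, ⟪∂[w] x z, W⟫ = ∂[w] (fun y => meanCurvature x (ν y) y) z) :
    -(n / ⟪x z, ν z⟫) ≤ ⟪x z, W⟫ - meanCurvature x (ν z) z := by
  obtain ⟨ξ, hξ⟩ := h.exists_eq_inner_normal_smul_add_dirDeriv hon (x z)
  have hlaplacian := h.sum_dirDeriv_dirDeriv_inner_normal
    (fun v => dirDeriv_eq_zero_of_isLocalMin hmin v) hon hξ
  have hnonneg : 0 ≤ ∑ i, ∂[coordVec i] (∂[coordVec i] fun y => ⟪x y, ν y⟫) z :=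
    Finset.sum_nonneg fun i _ => dirDeriv_dirDeriv_nonneg_of_isLocalMin
      (h.contDiffAt_two.inner ℝ h.contDiffAt_normal) hmin _
  have hxW : ⟪x z, W⟫ = ∂[ξ] (fun y => meanCurvature x (ν y) y) z := by
    conv_lhs => rw [hξ]
    rw [inner_add_left, real_inner_smul_left, hWν, mul_zero, zero_add, hW]
  have hsquare := h.two_mul_meanCurvature_le hon hpos
  linarith

end IsUnitNormalAt

end SupportFunction

section SmoothNormal

theorem eq_norm_inv_smul_inverse_apply {V : Type*} [NormedAddCommGroup V] [NormedSpace ℝ V]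
    {L : V →L[ℝ] V} (hL : IsUnit L) {v w : V} {c : ℝ} (hc : 0 < c) (hv : ‖v‖ = 1)
    (hLv : L v = c • w) : v = ‖Ring.inverse L w‖⁻¹ • Ring.inverse L w := by
  have hvw : v = c • Ring.inverse L w := by
    calc v = (Ring.inverse L * L) v := by rw [Ring.inverse_mul_cancel L hL]; rfl
      _ = c • Ring.inverse L w := by rw [← map_smul, ← hLv]; rfl
  have hnorm : c * ‖Ring.inverse L w‖ = 1 := by
    rw [← hv, hvw, norm_smul, Real.norm_of_nonneg hc.le]
  rwa [← eq_inv_of_mul_eq_one_left hnorm]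

variable {P ι V : Type*} [NormedAddCommGroup P] [NormedSpace ℝ P] [Fintype ι]
  [NormedAddCommGroup V] [InnerProductSpace ℝ V] [FiniteDimensional ℝ V]

-- Near `a`, the operator `L q = ⟨N(a), ·⟩ N(a) + ∑ ⟨bᵢ(q), ·⟩ bᵢ(a)` is invertible, and `N(q)` is
-- the normalization of `(L q)⁻¹ N(a)`.
theorem contDiffAt_of_forall_inner_eq_zero {m : WithTop ℕ∞} {b : ι → P → V} {N : P → V} {a : P}
    (hcard : Module.finrank ℝ V = Fintype.card ι + 1)
    (hb : ∀ i, ContDiffAt ℝ m (b i) a) (hon : Orthonormal ℝ fun i => b i a)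
    (hN : ContinuousAt N a) (hunit : ∀ᶠ q in 𝓝 a, ‖N q‖ = 1)
    (horth : ∀ᶠ q in 𝓝 a, ∀ i, ⟪b i q, N q⟫ = 0) : ContDiffAt ℝ m N a := by
  let L : P → V →L[ℝ] V := fun q =>
    (innerSL ℝ (N a)).smulRight (N a) + ∑ i, (innerSL ℝ (b i q)).smulRight (b i a)
  let R : P → V := fun q => Ring.inverse (L q) (N a)
  have hL : ContDiffAt ℝ m L a := contDiffAt_const.add <| ContDiffAt.sum fun i _ =>
    ((innerSL ℝ (E := V)).contDiff.contDiffAt.comp a (hb i)).smulRight contDiffAt_const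
  have hLa : L a = 1 := by
    ext1 v
    simpa [L] using (eq_inner_smul_add_sum_inner_smul hcard hon hunit.self_of_nhds
      horth.self_of_nhds v).symm
  have hR : ContDiffAt ℝ m R a := by
    have hinv : ContDiffAt ℝ m (Ring.inverse (M₀ := V →L[ℝ] V)) (L a) :=
      hLa ▸ contDiffAt_ringInverse ℝ (1 : (V →L[ℝ] V)ˣ)
    exact (hinv.comp a hL).clm_apply contDiffAt_const
  have hRa : R a ≠ 0 := by
    have : ‖R a‖ = 1 := by simpa [R, hLa] using hunit.self_of_nhds
    exact norm_ne_zero_iff.1 (by simp [this])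
  have hpos : ∀ᶠ q in 𝓝 a, 0 < ⟪N a, N q⟫ :=
    (continuousAt_const.inner hN).eventually_const_lt (by simp [hunit.self_of_nhds])
  have hLunit : ∀ᶠ q in 𝓝 a, IsUnit (L q) :=
    hL.continuousAt.eventually (Units.isOpen.mem_nhds (hLa ▸ isUnit_one))
  refine (((hR.norm ℝ hRa).inv (norm_ne_zero_iff.2 hRa)).smul hR).congr_of_eventuallyEq ?_
  filter_upwards [hunit, horth, hpos, hLunit] with q hunit horth hpos hLunit
  exact eq_norm_inv_smul_inverse_apply hLunit hpos hunit (by simp [L, horth])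

end SmoothNormal

section CoordinateFlow

variable {n : ℕ}

/-- Near `(z, t)`, the map `X` is a mean curvature flow with unit normal `N`, both read in
coordinates that do not depend on time. The evolution equation is imposed at time `t` only. -/
structure IsCoordFlowAt (X N : ℝ^n × ℝ → Amb n) (z : ℝ^n) (t : ℝ) : Prop where
  contDiffAt : ContDiffAt ℝ 3 X (z, t)
  contDiffAt_normal : ContDiffAt ℝ 2 N (z, t)
  norm_normal : ∀ᶠ q in 𝓝 (z, t), ‖N q‖ = 1
  inner_dirDeriv_normal : ∀ᶠ q in 𝓝 (z, t), ∀ w, ⟪∂[(w, (0 : ℝ))] X q, N q⟫ = 0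
  evolution : ∀ᶠ y in 𝓝 z, ∂[(0, (1 : ℝ))] X (y, t)
    = -(meanCurvature (fun y => X (y, t)) (N (y, t)) y) • N (y, t)

namespace IsCoordFlowAt

variable {X N : ℝ^n × ℝ → Amb n} {z : ℝ^n} {t : ℝ} (h : IsCoordFlowAt X N z t)

include h

theorem isUnitNormalAt_slice :
    IsUnitNormalAt (fun y => X (y, t)) (fun y => N (y, t)) z := by
  have hslice : ContDiff ℝ ω fun y : ℝ^n => (y, t) := by fun_prop
  have htendsto : Tendsto (fun y : ℝ^n => (y, t)) (𝓝 z) (𝓝 (z, t)) := hslice.continuous.tendsto z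
  refine ⟨h.contDiffAt.comp z (hslice.contDiffAt.of_le le_top),
    h.contDiffAt_normal.comp z (hslice.contDiffAt.of_le le_top),
    htendsto.eventually h.norm_normal, ?_⟩
  filter_upwards [htendsto.eventually h.inner_dirDeriv_normal,
    htendsto.eventually (h.contDiffAt.eventually (by simp))] with y horth hX w
  rw [dirDeriv_comp_prodMk (hX.differentiableAt three_ne_zero)]
  exact horth w

theorem differentiableAt : DifferentiableAt ℝ X (z, t) :=
  h.contDiffAt.differentiableAt three_ne_zero

theorem differentiableAt_normal : DifferentiableAt ℝ N (z, t) :=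
  h.contDiffAt_normal.differentiableAt two_ne_zero

theorem contDiffAt_dirDeriv (v : ℝ^n × ℝ) : ContDiffAt ℝ 2 (∂[v] X) (z, t) :=
  StarMCF.contDiffAt_dirDeriv h.contDiffAt v two_add_one_eq_three.le

theorem inner_normal_timeDeriv_normal : ⟪N (z, t), ∂[(0, (1 : ℝ))] N (z, t)⟫ = 0 := by
  have hneg := inner_dirDeriv_eq_neg h.differentiableAt_normal h.differentiableAt_normal
    (c := 1) (h.norm_normal.mono fun q hq => by simp [hq]) ((0 : ℝ^n), (1 : ℝ))
  rw [real_inner_comm (N (z, t))] at hneg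
  linarith

variable (hon : Orthonormal ℝ fun i => ∂[coordVec i] (fun y => X (y, t)) z)

include hon

theorem inner_dirDeriv_timeDeriv_normal (w : ℝ^n) :
    ⟪∂[w] (fun y => X (y, t)) z, ∂[(0, (1 : ℝ))] N (z, t)⟫
      = ∂[w] (fun y => meanCurvature (fun y => X (y, t)) (N (y, t)) y) z := by
  set H : ℝ^n → ℝ := fun y => meanCurvature (fun y => X (y, t)) (N (y, t)) y
  have hslice := h.isUnitNormalAt_slice
  have hunit : ⟪N (z, t), N (z, t)⟫ = 1 := hslice.inner_self_normal.self_of_nhds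
  have hvelocity : ∂[(w, (0 : ℝ))] (∂[(0, (1 : ℝ))] X) (z, t)
      = -(H z) • ∂[w] (fun y => N (y, t)) z + -(∂[w] H z) • N (z, t) := by
    rw [← dirDeriv_comp_prodMk ((h.contDiffAt_dirDeriv _).differentiableAt two_ne_zero),
      (dirDeriv_congr w h.evolution).eq_of_nhds]
    exact congrArg (· w) ((hslice.differentiableAt_meanCurvature hon).hasFDerivAt.fun_neg.fun_smul
      hslice.differentiableAt_normal.hasFDerivAt).fderiv
  calc ⟪∂[w] (fun y => X (y, t)) z, ∂[(0, (1 : ℝ))] N (z, t)⟫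
      = ⟪∂[(w, (0 : ℝ))] X (z, t), ∂[(0, (1 : ℝ))] N (z, t)⟫ := by
        rw [dirDeriv_comp_prodMk h.differentiableAt]
    _ = -⟪∂[(0, (1 : ℝ))] (∂[(w, (0 : ℝ))] X) (z, t), N (z, t)⟫ :=
        inner_dirDeriv_eq_neg ((h.contDiffAt_dirDeriv _).differentiableAt two_ne_zero)
          h.differentiableAt_normal (h.inner_dirDeriv_normal.mono fun _ hq => hq w) _
    _ = ∂[w] H z := by
        rw [dirDeriv_comm (h.contDiffAt.of_le (by norm_num)), hvelocity, inner_add_left,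
          real_inner_smul_left, real_inner_smul_left, hunit, real_inner_comm,
          hslice.inner_normal_dirDeriv_normal]
        ring

theorem exists_hasDerivAt_neg_div_le (hmin : IsLocalMin (fun y => ⟪X (y, t), N (y, t)⟫) z)
    (hpos : 0 < ⟪X (z, t), N (z, t)⟫) :
    ∃ u', HasDerivAt (fun s => ⟪X (z, s), N (z, s)⟫) u' t
      ∧ -(n / ⟪X (z, t), N (z, t)⟫) ≤ u' := by
  refine ⟨_, (hasDerivAt_comp_prodMk h.differentiableAt).inner ℝ
    (hasDerivAt_comp_prodMk h.differentiableAt_normal), ?_⟩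
  have hunit : ⟪N (z, t), N (z, t)⟫ = 1 := h.isUnitNormalAt_slice.inner_self_normal.self_of_nhds
  rw [h.evolution.self_of_nhds, real_inner_smul_left, hunit, mul_one, ← sub_eq_add_neg]
  exact h.isUnitNormalAt_slice.neg_div_le_of_isLocalMin hon hmin hpos
    h.inner_normal_timeDeriv_normal (h.inner_dirDeriv_timeDeriv_normal hon)

end IsCoordFlowAt

end CoordinateFlow

section Charts

open IsManifold

variable {n : ℕ} {M : Type*} [TopologicalSpace M] [ChartedSpace ℝ^n M]
  {e e' : OpenPartialHomeomorph M ℝ^n} {X : M → Amb n} {q : M} {y : ℝ^n}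

theorem contDiffAt_comp_symm_of_mem_maximalAtlas {G : Type*} [NormedAddCommGroup G]
    [NormedSpace ℝ G] {f : M → G} (he : e ∈ maximalAtlas (𝓡 n) ∞ M) (hy : y ∈ e.target)
    (hf : ContMDiffAt (𝓡 n) 𝓘(ℝ, G) ∞ f (e.symm y)) : ContDiffAt ℝ ∞ (f ∘ e.symm) y := by
  rw [← contMDiffAt_iff_contDiffAt]
  exact ContMDiffAt.comp y hf (contMDiffAt_symm_of_mem_maximalAtlas he hy)

theorem mDifferentiable_of_mem_maximalAtlas (he : e ∈ maximalAtlas (𝓡 n) ∞ M) :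
    e.MDifferentiable (𝓡 n) (𝓡 n) :=
  ⟨(contMDiffOn_of_mem_maximalAtlas he).mdifferentiableOn (by simp),
    (contMDiffOn_symm_of_mem_maximalAtlas he).mdifferentiableOn (by simp)⟩

theorem isInvertible_fderiv_comp_symm_of_mem_maximalAtlas (he : e ∈ maximalAtlas (𝓡 n) ∞ M)
    (he' : e' ∈ maximalAtlas (𝓡 n) ∞ M) (hq : q ∈ e.source) (hq' : q ∈ e'.source) :
    (fderiv ℝ (e ∘ e'.symm) (e' q)).IsInvertible := by
  have hsource : e' q ∈ (e'.symm.trans e).source := by simp [hq, hq']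
  refine ⟨((mDifferentiable_of_mem_maximalAtlas he').symm.trans
    (mDifferentiable_of_mem_maximalAtlas he)).mfderiv hsource, ?_⟩
  exact mfderiv_eq_fderiv

theorem meanCurvature_comp_symm_of_mem_maximalAtlas [IsManifold (𝓡 n) ∞ M] {N : Amb n}
    (he : e ∈ maximalAtlas (𝓡 n) ∞ M) (hy : y ∈ e.target)
    (hX : ContMDiffAt (𝓡 n) 𝓘(ℝ, Amb n) ∞ X (e.symm y))
    (hN : ∀ w, ⟪∂[w] (X ∘ e.symm) y, N⟫ = 0) :
    meanCurvature (X ∘ e.symm) N y = meanCurvature X N (e.symm y) := by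
  set q := e.symm y
  have hq : q ∈ e.source := e.map_target hy
  set φ := chartAt ℝ^n q
  have hφ : φ ∈ maximalAtlas (𝓡 n) ∞ M := chart_mem_maximalAtlas q
  have hqφ : q ∈ φ.source := mem_chart_source _ q
  have hψ : (e ∘ φ.symm) (φ q) = y :=
    (congrArg e (φ.left_inv hqφ)).trans (e.right_inv hy)
  have htransition : ContDiffAt ℝ ∞ (e ∘ φ.symm) (φ q) :=
    contDiffAt_comp_symm_of_mem_maximalAtlas hφ (φ.map_source hqφ)
      (by simpa only [φ.left_inv hqφ] using contMDiffAt_of_mem_maximalAtlas he hq)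
  have hlocal : (X ∘ e.symm) ∘ (e ∘ φ.symm) =ᶠ[𝓝 (φ q)] X ∘ φ.symm := by
    have htendsto : Tendsto φ.symm (𝓝 (φ q)) (𝓝 q) := by
      simpa only [φ.left_inv hqφ] using (φ.continuousAt_symm (φ.map_source hqφ)).tendsto
    filter_upwards [htendsto.eventually (e.open_source.mem_nhds hq)] with y hy
    simp [e.left_inv hy]
  calc meanCurvature (X ∘ e.symm) N y
      = meanCurvature ((X ∘ e.symm) ∘ (e ∘ φ.symm)) N (φ q) := by
        rw [meanCurvature_comp _ (htransition.of_le ENat.LEInfty.out)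
          (isInvertible_fderiv_comp_symm_of_mem_maximalAtlas he hφ hq hqφ) (hψ ▸ hN), hψ]
        rw [hψ]
        exact (contDiffAt_comp_symm_of_mem_maximalAtlas he hy hX).of_le ENat.LEInfty.out
    _ = meanCurvature (X ∘ φ.symm) N (φ q) := meanCurvature_congr hlocal N
    _ = meanCurvature X N q := rfl

theorem exists_orthonormal_apply_coordVec {V : Type*} [NormedAddCommGroup V]
    [InnerProductSpace ℝ V] {A : ℝ^n →L[ℝ] V} (hA : Function.Injective A) :
    ∃ E : ℝ^n ≃L[ℝ] ℝ^n, Orthonormal ℝ fun i => A (E (coordVec i)) := by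
  set e := LinearEquiv.ofInjective A.toLinearMap hA
  have hrank : Module.finrank ℝ (LinearMap.range A.toLinearMap) = n := by
    simp [← e.finrank_eq]
  set b := (stdOrthonormalBasis ℝ (LinearMap.range A.toLinearMap)).reindex (finCongr hrank)
  have hb (i : Fin n) : A (e.symm (b.repr.symm (coordVec i))) = b i := by
    rw [b.repr_symm_single]
    exact congrArg Subtype.val (e.apply_symm_apply (b i))
  refine ⟨(b.repr.symm.toLinearEquiv.trans e.symm).toContinuousLinearEquiv, ?_⟩
  change Orthonormal ℝ fun i => A (e.symm (b.repr.symm (coordVec i)))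
  simp only [hb]
  exact b.orthonormal.comp_linearIsometry (Submodule.subtypeₗᵢ _)

theorem transHomeomorph_mem_maximalAtlas [IsManifold (𝓡 n) ∞ M]
    (he : e ∈ maximalAtlas (𝓡 n) ∞ M) (E : ℝ^n ≃L[ℝ] ℝ^n) :
    e.transHomeomorph E.toHomeomorph ∈ maximalAtlas (𝓡 n) ∞ M :=
  OpenPartialHomeomorph.mem_maximalAtlas_of_contMDiffOn _
    (E.contDiff.contMDiff.comp_contMDiffOn (contMDiffOn_of_mem_maximalAtlas he))
    ((contMDiffOn_symm_of_mem_maximalAtlas he).comp E.symm.contDiff.contMDiff.contMDiffOn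
      fun _ hy => hy)

theorem exists_chart_orthonormal [IsManifold (𝓡 n) ∞ M]
    (hX : ContMDiffAt (𝓡 n) 𝓘(ℝ, Amb n) ∞ X q)
    (hinj : Function.Injective (mfderiv (𝓡 n) 𝓘(ℝ, Amb n) X q)) :
    ∃ e ∈ maximalAtlas (𝓡 n) ∞ M, q ∈ e.source ∧
      Orthonormal ℝ fun i => ∂[coordVec i] (X ∘ e.symm) (e q) := by
  set φ := chartAt ℝ^n q
  have hφ : φ ∈ maximalAtlas (𝓡 n) ∞ M := chart_mem_maximalAtlas q
  have hqφ : q ∈ φ.source := mem_chart_source _ q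
  have hfderiv : mfderiv (𝓡 n) 𝓘(ℝ, Amb n) X q = fderiv ℝ (X ∘ φ.symm) (φ q) := by
    rw [(hX.mdifferentiableAt (by simp)).mfderiv, ModelWithCorners.range_eq_univ,
      fderivWithin_univ]
    rfl
  obtain ⟨E, hE⟩ := exists_orthonormal_apply_coordVec (A := fderiv ℝ (X ∘ φ.symm) (φ q))
    (hfderiv ▸ hinj)
  refine ⟨φ.transHomeomorph E.symm.toHomeomorph, transHomeomorph_mem_maximalAtlas hφ E.symm,
    hqφ, ?_⟩
  have hcoord : ContDiffAt ℝ ∞ (X ∘ φ.symm) (φ q) :=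
    contDiffAt_comp_symm_of_mem_maximalAtlas hφ (φ.map_source hqφ) (by rwa [φ.left_inv hqφ])
  have hEφ : E (E.symm (φ q)) = φ q := E.apply_symm_apply _
  have hcomp : HasFDerivAt ((X ∘ φ.symm) ∘ E)
      ((fderiv ℝ (X ∘ φ.symm) (φ q)).comp (E : ℝ^n →L[ℝ] ℝ^n)) (E.symm (φ q)) := by
    refine HasFDerivAt.comp _ ?_ E.hasFDerivAt
    rw [hEφ]
    exact (hcoord.differentiableAt (by simp)).hasFDerivAt
  have hdir (i : Fin n) : ∂[coordVec i] ((X ∘ φ.symm) ∘ E) (E.symm (φ q))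
      = fderiv ℝ (X ∘ φ.symm) (φ q) (E (coordVec i)) := congrArg (· (coordVec i)) hcomp.fderiv
  simp only [← hdir] at hE
  exact hE

end Charts

namespace IsMeanCurvatureFlow

open IsManifold

section Coordinates

variable {n : ℕ} {M : Type*} [TopologicalSpace M] [ChartedSpace ℝ^n M] {Tc t : ℝ}
  {F ν : M → ℝ → Amb n} (hF : IsMeanCurvatureFlow Tc F ν) (ht : t ∈ Ioo 0 Tc)

include hF ht

theorem contMDiffAt (q : M) :
    ContMDiffAt ((𝓡 n).prod 𝓘(ℝ, ℝ)) 𝓘(ℝ, Amb n) ∞ (fun q : M × ℝ => F q.1 q.2) (q, t) :=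
  hF.smooth.contMDiffAt (prod_mem_nhds univ_mem (Ico_mem_nhds ht.1 ht.2))

theorem contMDiffAt_slice (q : M) : ContMDiffAt (𝓡 n) 𝓘(ℝ, Amb n) ∞ (fun q => F q t) q :=
  ContMDiffAt.comp (g := fun q : M × ℝ => F q.1 q.2) q (hF.contMDiffAt ht q)
    (contMDiffAt_id.prodMk contMDiffAt_const)

theorem continuousAt_normal_coord {e : OpenPartialHomeomorph M ℝ^n} {y : ℝ^n}
    (hy : y ∈ e.target) :
    ContinuousAt (fun q : ℝ^n × ℝ => ν (e.symm q.1) q.2) (y, t) := by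
  have hν : ContinuousAt (fun q : M × ℝ => ν q.1 q.2) (e.symm y, t) :=
    hF.normal_continuous.continuousAt (prod_mem_nhds univ_mem (Ico_mem_nhds ht.1 ht.2))
  have hchart : ContinuousAt (fun q : ℝ^n × ℝ => (e.symm q.1, q.2)) (y, t) :=
    ((e.continuousAt_symm hy).comp (x := (y, t)) continuousAt_fst).prodMk continuousAt_snd
  exact ContinuousAt.comp (x := (y, t)) hν hchart

variable {e : OpenPartialHomeomorph M ℝ^n} (he : e ∈ maximalAtlas (𝓡 n) ∞ M) {y : ℝ^n}
  (hy : y ∈ e.target)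

include he hy

theorem contDiffAt_coord :
    ContDiffAt ℝ ∞ (fun q : ℝ^n × ℝ => F (e.symm q.1) q.2) (y, t) := by
  rw [← contMDiffAt_iff_contDiffAt, modelWithCornersSelf_prod, ← chartedSpaceSelf_prod]
  exact ContMDiffAt.comp (g := fun q : M × ℝ => F q.1 q.2) (y, t) (hF.contMDiffAt ht _)
    ((ContMDiffAt.comp (y, t) (contMDiffAt_symm_of_mem_maximalAtlas he hy)
      contMDiffAt_fst).prodMk contMDiffAt_snd)

theorem inner_dirDeriv_normal_coord (w : ℝ^n) :
    ⟪∂[w] (fun y => F (e.symm y) t) y, ν (e.symm y) t⟫ = 0 := by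
  have hchain := mfderiv_comp (I' := 𝓡 n) y
    ((hF.contMDiffAt_slice ht (e.symm y)).mdifferentiableAt (by simp))
    ((mDifferentiable_of_mem_maximalAtlas he).mdifferentiableAt_symm hy)
  rw [mfderiv_eq_fderiv] at hchain
  have hw : ∂[w] (fun y => F (e.symm y) t) y = _ := congrArg (· w) hchain
  rw [hw]
  exact hF.normal_orthogonal t (Ioo_subset_Ico_self ht) _ _

theorem timeDeriv_coord [IsManifold (𝓡 n) ∞ M] :
    ∂[(0, (1 : ℝ))] (fun q : ℝ^n × ℝ => F (e.symm q.1) q.2) (y, t)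
      = -(meanCurvature (fun y => F (e.symm y) t) (ν (e.symm y) t) y) • ν (e.symm y) t := by
  have hevol := (hF.evolution t (Ioo_subset_Ico_self ht) (e.symm y)).hasDerivAt
    (Ico_mem_nhds ht.1 ht.2)
  rw [← meanCurvature_comp_symm_of_mem_maximalAtlas he hy (hF.contMDiffAt_slice ht _)
    (hF.inner_dirDeriv_normal_coord ht he hy)] at hevol
  exact (hasDerivAt_comp_prodMk
    ((hF.contDiffAt_coord ht he hy).differentiableAt (by simp))).unique hevol

theorem isCoordFlowAt [IsManifold (𝓡 n) ∞ M]
    (hon : Orthonormal ℝ fun i => ∂[coordVec i] (fun y => F (e.symm y) t) y) :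
    IsCoordFlowAt (fun q => F (e.symm q.1) q.2) (fun q => ν (e.symm q.1) q.2) y t := by
  have hX := hF.contDiffAt_coord ht he hy
  have hdom : e.target ×ˢ Ioo 0 Tc ∈ 𝓝 (y, t) :=
    prod_mem_nhds (e.open_target.mem_nhds hy) (Ioo_mem_nhds ht.1 ht.2)
  have hunit : ∀ᶠ q in 𝓝 (y, t), ‖ν (e.symm q.1) q.2‖ = 1 :=
    mem_of_superset hdom fun q hq => hF.normal_unit q.2 (Ioo_subset_Ico_self hq.2) _
  have horth : ∀ᶠ q in 𝓝 (y, t), ∀ w,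
      ⟪∂[(w, (0 : ℝ))] (fun q : ℝ^n × ℝ => F (e.symm q.1) q.2) q, ν (e.symm q.1) q.2⟫ = 0 := by
    filter_upwards [hdom] with q hq w
    have hspace := hF.inner_dirDeriv_normal_coord hq.2 he hq.1 w
    rwa [dirDeriv_comp_prodMk (f := fun q : ℝ^n × ℝ => F (e.symm q.1) q.2)
      ((hF.contDiffAt_coord hq.2 he hq.1).differentiableAt (by simp)) w] at hspace
  have hslice (w : ℝ^n) : ∂[w] (fun y => F (e.symm y) t) y = _ :=
    dirDeriv_comp_prodMk (hX.differentiableAt (by simp)) w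
  simp only [hslice] at hon
  exact
    { contDiffAt := hX.of_le ENat.LEInfty.out
      contDiffAt_normal := contDiffAt_of_forall_inner_eq_zero (by simp)
        (fun i => contDiffAt_dirDeriv (hX.of_le ENat.LEInfty.out) _ two_add_one_eq_three.le) hon
        (hF.continuousAt_normal_coord ht hy) hunit (horth.mono fun q hq i => hq _)
      norm_normal := hunit
      inner_dirDeriv_normal := horth
      evolution := by
        filter_upwards [e.open_target.mem_nhds hy] with y hy using hF.timeDeriv_coord ht he hy }

end Coordinates

variable {n : ℕ} {M : Type*} [TopologicalSpace M] [ChartedSpace ℝ^n M] {Tc t : ℝ}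
  {F ν : M → ℝ → Amb n}

theorem exists_hasDerivAt_neg_div_le [IsManifold (𝓡 n) ∞ M] (hF : IsMeanCurvatureFlow Tc F ν)
    (ht : t ∈ Ioo 0 Tc) {p : M} (hmin : IsLocalMin (fun q => ⟪F q t, ν q t⟫) p)
    (hpos : 0 < ⟪F p t, ν p t⟫) :
    ∃ u', HasDerivAt (fun s => ⟪F p s, ν p s⟫) u' t ∧ -(n / ⟪F p t, ν p t⟫) ≤ u' := by
  obtain ⟨e, he, hp, hon⟩ := exists_chart_orthonormal (hF.contMDiffAt_slice ht p)
    (hF.immersion t (Ioo_subset_Ico_self ht) p)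
  have hp' := e.map_source hp
  have hmin' : IsLocalMin (fun y => ⟪F (e.symm y) t, ν (e.symm y) t⟫) (e p) := by
    have htendsto := (e.continuousAt_symm hp').tendsto
    rw [e.left_inv hp] at htendsto
    simpa [IsLocalMin, IsMinFilter, e.left_inv hp] using htendsto.eventually hmin
  have hcoord := (hF.isCoordFlowAt ht he hp' hon).exists_hasDerivAt_neg_div_le hon hmin'
  simp only [e.left_inv hp] at hcoord
  exact hcoord hpos

end IsMeanCurvatureFlow

section MaximumPrinciple

theorem nonpos_of_hasDerivAt_of_eventually_le {f : ℝ → ℝ} {f' t : ℝ} (hf : HasDerivAt f f' t)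
    (h : ∀ᶠ s in 𝓝[<] t, f t ≤ f s) : f' ≤ 0 := by
  refine le_of_tendsto (hf.tendsto_slope.mono_left (nhdsLT_le_nhdsNE t)) ?_
  filter_upwards [h, self_mem_nhdsWithin] with s hs hst
  rw [slope_def_field]
  exact div_nonpos_of_nonneg_of_nonpos (sub_nonneg.2 hs) (sub_nonpos.2 (le_of_lt hst))

variable {M : Type*} [TopologicalSpace M] [CompactSpace M] {v : M → ℝ → ℝ} {T : ℝ}

theorem exists_first_nonpos
    (hv : ContinuousOn (fun q : M × ℝ => v q.1 q.2) (univ ×ˢ Icc 0 T))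
    (hcontact : ∃ t ∈ Icc 0 T, ∃ p, v p t ≤ 0) :
    ∃ t ∈ Icc 0 T, (∃ p, v p t ≤ 0) ∧ ∀ s ∈ Ico 0 t, ∀ q, 0 < v q s := by
  set S : Set (M × ℝ) := univ ×ˢ Icc 0 T ∩ (fun q => v q.1 q.2) ⁻¹' Iic 0
  have hcompact : IsCompact S :=
    (isCompact_univ.prod isCompact_Icc).of_isClosed_subset
      (hv.preimage_isClosed_of_isClosed (isClosed_univ.prod isClosed_Icc) isClosed_Iic)
      inter_subset_left
  obtain ⟨t₁, ht₁, p₁, hp₁⟩ := hcontact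
  obtain ⟨⟨p, t⟩, ⟨⟨-, ht⟩, hp⟩, hfirst⟩ := hcompact.exists_isMinOn
    ⟨(p₁, t₁), ⟨mem_univ _, ht₁⟩, hp₁⟩ continuousOn_snd
  refine ⟨t, ht, ⟨p, hp⟩, fun s hs q => ?_⟩
  by_contra! hq
  have hts : t ≤ s :=
    hfirst (show (q, s) ∈ S from ⟨⟨mem_univ _, hs.1, hs.2.le.trans ht.2⟩, hq⟩)
  exact hts.not_gt hs.2

theorem forall_pos_of_exists_hasDerivAt_pos
    (hv : ContinuousOn (fun q : M × ℝ => v q.1 q.2) (univ ×ˢ Icc 0 T)) (h0 : ∀ p, 0 < v p 0)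
    (hderiv : ∀ t ∈ Ioc 0 T, ∀ p, v p t = 0 → (∀ q, 0 ≤ v q t) →
      ∃ v', HasDerivAt (v p) v' t ∧ 0 < v') :
    ∀ t ∈ Icc 0 T, ∀ p, 0 < v p t := by
  by_contra! hcontact
  obtain ⟨t, ht, ⟨p, hp⟩, hbefore⟩ := exists_first_nonpos hv hcontact
  have htpos : 0 < t := ht.1.lt_of_ne fun h => (h0 p).not_ge (h ▸ hp)
  have hleft : ∀ᶠ s in 𝓝[<] t, s ∈ Ico 0 t := Ico_mem_nhdsLT htpos
  have hnonneg (q : M) : 0 ≤ v q t := by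
    have hslice : ContinuousOn (v q) (Icc 0 T) :=
      hv.comp (f := fun s => (q, s)) (by fun_prop) fun s hs => ⟨mem_univ _, hs⟩
    have hleft' : 𝓝[<] t ≤ 𝓝[Icc 0 T] t :=
      le_inf nhdsWithin_le_nhds (le_principal_iff.2
        (mem_of_superset (Ico_mem_nhdsLT htpos) fun s hs => ⟨hs.1, hs.2.le.trans ht.2⟩))
    refine ge_of_tendsto ((hslice t ht).mono_left hleft') ?_
    filter_upwards [hleft] with s hs using (hbefore s hs q).le
  have hzero : v p t = 0 := hp.antisymm (hnonneg p)
  obtain ⟨v', hv', hpos⟩ := hderiv t ⟨htpos, ht.2⟩ p hzero hnonneg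
  refine (nonpos_of_hasDerivAt_of_eventually_le hv' ?_).not_gt hpos
  filter_upwards [hleft] with s hs using hp.trans (hbefore s hs p).le

end MaximumPrinciple

namespace IsMeanCurvatureFlow

variable {n : ℕ} {M : Type*} [TopologicalSpace M] [ChartedSpace ℝ^n M] {Tc : ℝ}
  {F ν : M → ℝ → Amb n}

theorem continuousOn_inner (hF : IsMeanCurvatureFlow Tc F ν) :
    ContinuousOn (fun q : M × ℝ => ⟪F q.1 q.2, ν q.1 q.2⟫) (univ ×ˢ Ico 0 Tc) :=
  hF.smooth.continuousOn.inner hF.normal_continuous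

theorem continuous_inner_zero (hF : IsMeanCurvatureFlow Tc F ν) (hTc : 0 < Tc) :
    Continuous fun p => ⟪F p 0, ν p 0⟫ :=
  hF.continuousOn_inner.comp_continuous (f := fun p => (p, (0 : ℝ))) (by fun_prop)
    fun p => ⟨mem_univ p, left_mem_Ico.2 hTc⟩

theorem inner_le_diam [CompactSpace M] (hF : IsMeanCurvatureFlow Tc F ν) (hTc : 0 < Tc) (p : M) :
    ⟪F p 0, ν p 0⟫ ≤ Metric.diam (insert 0 (range fun p => F p 0)) := by
  have hcont : Continuous fun p => F p 0 :=
    hF.smooth.continuousOn.comp_continuous (f := fun p => (p, (0 : ℝ))) (by fun_prop)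
      fun p => ⟨mem_univ p, left_mem_Ico.2 hTc⟩
  calc ⟪F p 0, ν p 0⟫ ≤ ‖F p 0‖ * ‖ν p 0‖ := real_inner_le_norm _ _
    _ = dist (F p 0) 0 := by
      rw [hF.normal_unit 0 (left_mem_Ico.2 hTc), mul_one, dist_zero_right]
    _ ≤ _ := Metric.dist_le_diam_of_mem ((isCompact_range hcont).isBounded.insert 0)
      (mem_insert_of_mem _ (mem_range_self p)) (mem_insert _ _)

variable [IsManifold (𝓡 n) ∞ M] [CompactSpace M] {m t : ℝ}

-- The `ε`-terms make the barrier strictly steeper than the shrinking sphere, so `⟪F, ν⟫` cannot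
-- touch it.
theorem sqrt_lt_inner (hF : IsMeanCurvatureFlow Tc F ν) (hm : 0 < m)
    (h0 : ∀ p, m ≤ ⟪F p 0, ν p 0⟫) (ht : t ∈ Ico 0 Tc) {ε : ℝ} (hε : 0 < ε)
    (hroom : 0 < m ^ 2 - ε - (2 * n + ε) * t) (p : M) :
    √(m ^ 2 - ε - (2 * n + ε) * t) < ⟪F p t, ν p t⟫ := by
  set b : ℝ → ℝ := fun s => √(m ^ 2 - ε - (2 * n + ε) * s) with hb
  suffices ∀ s ∈ Icc 0 t, ∀ p, 0 < ⟪F p s, ν p s⟫ - b s from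
    sub_pos.1 (this t (right_mem_Icc.2 ht.1) p)
  refine forall_pos_of_exists_hasDerivAt_pos ?_ (fun p => sub_pos.2 ?_) fun s hs p hp hmin => ?_
  · exact (hF.continuousOn_inner.mono (prod_mono_right (Icc_subset_Ico_right ht.2))).sub
      (by fun_prop)
  · refine lt_of_lt_of_le ?_ (h0 p)
    rw [hb, Real.sqrt_lt' hm]
    linarith
  · have hbpos : 0 < m ^ 2 - ε - (2 * n + ε) * s :=
      hroom.trans_le (by gcongr; exact hs.2)
    have hbs : 0 < b s := Real.sqrt_pos.2 hbpos
    have hb' : HasDerivAt b (-(2 * n + ε) / (2 * b s)) s := by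
      have hlin : HasDerivAt (fun s => m ^ 2 - ε - (2 * n + ε) * s) (-(2 * n + ε)) s := by
        simpa using ((hasDerivAt_id s).const_mul (2 * n + ε)).const_sub (m ^ 2 - ε)
      exact hlin.sqrt hbpos.ne'
    rw [sub_eq_zero] at hp
    obtain ⟨u', hu', hle⟩ := hF.exists_hasDerivAt_neg_div_le ⟨hs.1, hs.2.trans_lt ht.2⟩ (p := p)
      (Eventually.of_forall fun q => hp.trans_le (sub_nonneg.1 (hmin q))) (hp ▸ hbs)
    refine ⟨_, hu'.sub hb', ?_⟩
    rw [hp] at hle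
    have hgap : -(2 * n + ε) / (2 * b s) = -(n / b s) - ε / (2 * b s) := by
      field_simp
      ring
    linarith [div_pos hε (mul_pos two_pos hbs)]

theorem sqrt_le_inner (hF : IsMeanCurvatureFlow Tc F ν) (hm : 0 < m)
    (h0 : ∀ p, m ≤ ⟪F p 0, ν p 0⟫) (ht : t ∈ Ico 0 Tc) (hmt : 2 * n * t < m ^ 2) (p : M) :
    √(m ^ 2 - 2 * n * t) ≤ ⟪F p t, ν p t⟫ := by
  have hcont : Continuous fun ε : ℝ => m ^ 2 - ε - (2 * n + ε) * t := by fun_prop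
  have hroom : ∀ᶠ ε in 𝓝[>] (0 : ℝ), 0 < m ^ 2 - ε - (2 * n + ε) * t :=
    (hcont.continuousAt.eventually_const_lt (by simpa using hmt)).filter_mono nhdsWithin_le_nhds
  have hlim : Tendsto (fun ε : ℝ => √(m ^ 2 - ε - (2 * n + ε) * t)) (𝓝[>] 0)
      (𝓝 √(m ^ 2 - 2 * n * t)) := by
    have h := (hcont.sqrt.tendsto 0).mono_left (nhdsWithin_le_nhds (s := Ioi 0))
    simpa only [sub_zero, add_zero] using h
  refine le_of_tendsto hlim ?_
  filter_upwards [hroom, self_mem_nhdsWithin] with ε hroom hε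
  exact (hF.sqrt_lt_inner hm h0 ht hε hroom p).le

theorem half_le_inner (hF : IsMeanCurvatureFlow Tc F ν) (hm : 0 < m)
    (h0 : ∀ p, m ≤ ⟪F p 0, ν p 0⟫) (ht : t ∈ Ico 0 Tc) (hmt : 8 * n * t ≤ 3 * m ^ 2) (p : M) :
    m / 2 ≤ ⟪F p t, ν p t⟫ := by
  refine le_trans (Real.le_sqrt_of_sq_le ?_) (hF.sqrt_le_inner hm h0 ht ?_ p) <;>
    nlinarith [sq_pos_of_pos hm]

end IsMeanCurvatureFlow

theorem eight_mul_le_three_mul_inv_sq {n R f t : ℝ} (hn : 0 ≤ n) (hf : 0 < f) (ht : 0 ≤ t)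
    (hR : 1 ≤ R * f) (hle : t ≤ 1 / (4 * (n + 1) * (R ^ 2 + 1) * f ^ 4)) :
    8 * n * t ≤ 3 * f⁻¹ ^ 2 := by
  have hRf : 1 ≤ (R ^ 2 + 1) * f ^ 2 := by nlinarith
  have hft : 4 * n * t * f ^ 2 ≤ 1 :=
    calc 4 * n * t * f ^ 2 ≤ 4 * (n + 1) * t * f ^ 2 * ((R ^ 2 + 1) * f ^ 2) :=
          (by gcongr; linarith : _ ≤ 4 * (n + 1) * t * f ^ 2).trans
            (le_mul_of_one_le_right (by positivity) hRf)
      _ = t * (4 * (n + 1) * (R ^ 2 + 1) * f ^ 4) := by ring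
      _ ≤ 1 := (le_div_iff₀ (by positivity)).1 hle
  rw [inv_pow, ← div_eq_mul_inv, le_div_iff₀ (by positivity)]
  linarith

end StarMCF

end

theorem theorem1_general (n : ℕ) (M₀ : Set (StarMCF.Amb n)) :
    ∃ G : ℝ, 0 < G ∧ ∀ T₀ : ℝ, 0 < T₀ →
      ∀ (M : Type*) [TopologicalSpace M] [CompactSpace M] [Nonempty M]
        [ChartedSpace (EuclideanSpace ℝ (Fin n)) M] [IsManifold (𝓡 n) ∞ M]
        (Tc : ℝ) (F ν : M → ℝ → StarMCF.Amb n),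
        StarMCF.IsMeanCurvatureFlow Tc F ν →
        Set.range (fun p => F p 0) = M₀ →
        StarMCF.IsStarShaped (fun p => F p 0) (fun p => ν p 0) →
        T₀ < Tc →
        ∃ f₀ : ℝ, IsGreatest (Set.range fun p : M => (inner ℝ (F p 0) (ν p 0))⁻¹) f₀ ∧
          0 < min (1 / (G * f₀ ^ 4)) T₀ ∧ min (1 / (G * f₀ ^ 4)) T₀ ≤ T₀ ∧
          ∀ t ∈ Set.Icc 0 (min (1 / (G * f₀ ^ 4)) T₀), ∀ p : M,
            0 < inner ℝ (F p t) (ν p t) ∧ (inner ℝ (F p t) (ν p t))⁻¹ ≤ 2 * f₀ := by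
  set R := Metric.diam (insert 0 M₀)
  refine ⟨4 * (n + 1) * (R ^ 2 + 1), by positivity, ?_⟩
  intro T₀ hT₀ M _ _ _ _ _ Tc F ν hF hM₀ hstar hTc
  have hTcpos : 0 < Tc := hT₀.trans hTc
  obtain ⟨f₀, hf₀⟩ := (isCompact_range ((hF.continuous_inner_zero hTcpos).inv₀
    fun p => (hstar p).ne')).exists_isGreatest (range_nonempty _)
  obtain ⟨p₀, hp₀⟩ := hf₀.1
  have hf₀pos : 0 < f₀ := hp₀ ▸ inv_pos.2 (hstar p₀)
  have hR : 1 ≤ R * f₀ := by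
    simp only [← hp₀, Pi.inv_apply, ← div_eq_mul_inv, R, ← hM₀]
    exact (one_le_div (hstar p₀)).2 (hF.inner_le_diam hTcpos p₀)
  refine ⟨f₀, hf₀, lt_min (by positivity) hT₀, min_le_right _ _, fun t ht p => ?_⟩
  have hhalf : f₀⁻¹ / 2 ≤ inner ℝ (F p t) (ν p t) :=
    hF.half_le_inner (inv_pos.2 hf₀pos)
      (fun q => inv_le_of_inv_le₀ (hstar q) (hf₀.2 (mem_range_self q)))
      ⟨ht.1, (ht.2.trans (min_le_right _ _)).trans_lt hTc⟩
      (StarMCF.eight_mul_le_three_mul_inv_sq n.cast_nonneg hf₀pos ht.1 hR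
        (ht.2.trans (min_le_left _ _))) p
  refine ⟨(by positivity : 0 < f₀⁻¹ / 2).trans_le hhalf, ?_⟩
  simpa [mul_comm] using inv_anti₀ (by positivity) hhalf

theorem theorem1 (n : ℕ) (hn : 1 ≤ n) (M₀ : Set (StarMCF.Amb n)) :
    ∃ c₃ : ℝ, 0 < c₃ ∧ ∀ T₀ : ℝ, 0 < T₀ → ∃ G : ℝ, 0 < G ∧
      ∀ (M : Type*) [TopologicalSpace M] [T2Space M] [CompactSpace M] [Nonempty M]
        [ChartedSpace (EuclideanSpace ℝ (Fin n)) M] [IsManifold (𝓡 n) ∞ M]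
        (Tc : ℝ) (F ν : M → ℝ → StarMCF.Amb n),
        StarMCF.IsMeanCurvatureFlow Tc F ν →
        Set.range (fun p => F p 0) = M₀ →
        StarMCF.IsStarShaped (fun p => F p 0) (fun p => ν p 0) →
        T₀ < Tc →
        ∃ f₀ : ℝ, IsGreatest (Set.range fun p : M => (inner ℝ (F p 0) (ν p 0))⁻¹) f₀ ∧
          0 < min (1 / (G * f₀ ^ 4)) T₀ ∧ min (1 / (G * f₀ ^ 4)) T₀ ≤ T₀ ∧
          ∀ t ∈ Set.Icc 0 (min (1 / (G * f₀ ^ 4)) T₀), ∀ p : M,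
            0 < inner ℝ (F p t) (ν p t) ∧ (inner ℝ (F p t) (ν p t))⁻¹ ≤ 2 * c₃ * f₀ := by
  obtain ⟨G, hG, h⟩ := theorem1_general n M₀
  exact ⟨1, one_pos, fun T₀ hT₀ => ⟨G, hG, fun M _ _ _ _ _ _ => by
    simpa only [mul_one] using h T₀ hT₀ M⟩⟩
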